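/- Let $T$ be a first-order theory in an arbitrary language (not assumed complete) and let $\phi(x,y)$ be a formula without parameters, where $x$ and $y$ are finite tuples of variables. All models are nonempty, and $a\in M$, $b\in M$ mean that $a$, $b$ are tuples from $M$ of the length of $x$, $y$ respectively. Automorphisms act coordinatewise on tuples. The formula $\phi$ has the *order property* (with respect to $T$) if there is a model $M$ of $T$ such that for every $n\in\mathbb N$ there are $a_1,\dots,a_n$ and $b_1,\dots,b_n$ in $M$ with $M\models\phi(a_i,b_j)\iff i\le j$ for all $1\le i,j\le n$. Let $2^{\mathbb Z}$ be the space of binary $\mathbb Z$-sequences with the product topology, identified with the set of subsets of $\mathbb Z$. For a model $M$, $b\in M$, $U=\phi(M,b)=\{a\in M: M\models\phi(a,b)\}$ and $\sigma\in\mathrm{Aut}(M)$, put $\xi_{\sigma,U}(a)=\{i\in\mathbb Z:\sigma^i(a)\in U\}\in 2^{\mathbb Z}$ and $\xi_{\sigma,U}(M)=\{\xi_{\sigma,U}(a):a\in M\}$. Let $\rho_\phi(M)=\bigcup_{b\in M}\bigcup_{\sigma\in\mathrm{Aut}(M)}\xi_{\sigma,\phi(M,b)}(M)$. Let $\bar1\bar0\in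 2^{\mathbb Z}$ be the sequence with $\bar1\bar0(i)=1$ for $i\le 0$ and $\bar1\bar0(i)=0$ for $i>0$, and let $(\bar1\bar0)_n$ be its finite part from coordinate $-n$ to coordinate $n$; a sequence $I\in 2^{\mathbb Z}$ contains $(\bar1\bar0)_n$ if there is $k\in\mathbb Z$ with $I(k+i)=\bar1\bar0(i)$ for all $-n\le i\le n$. Let $W_b$ be the set of $\sigma\in\mathrm{Aut}(M)$ such that $(\sigma^i(b))_{i\in\mathbb Z}$ is an indiscernible sequence over $\emptyset$ (with respect to the order of $\mathbb Z$). Then the following are equivalent. 1. $\phi(x,y)$ has the order property. 2. There are a model $M$ of $T$, $b\in M$ with $U=\phi(M,b)$, $\sigma\in\mathrm{Aut}(M)$ and $a\in M$ such that $\xi_{\sigma,U}(a)=\bar1\bar0$. 3. The same as 2, with in addition $\sigma\in W_b$. 4. There are a model $M$ of $T$, $b\in M$ with $U=\phi(M,b)$, and $\sigma\in\mathrm{Aut}(M)$ such that for every $n\in\mathbb N$ some element of $\xi_{\sigma,U}(M)$ contains $(\bar1\bar0)_n$. 5. There are a model $M$ of $T$ and $\sigma\in\mathrm{Aut}(M)$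 such that for every $n\in\mathbb N$ there is $b_n\in M$ with $U_n=\phi(M,b_n)$ such that some element of $\xi_{\sigma,U_n}(M)$ contains $(\bar1\bar0)_n$. 6. There are a model $M$ of $T$, $b\in M$ with $U=\phi(M,b)$, and $\sigma\in\mathrm{Aut}(M)$ such that $\bar1\bar0$ lies in the topological closure of $\xi_{\sigma,U}(M)$ in $2^{\mathbb Z}$. 7. There is a model $M$ of $T$ such that $\bar1\bar0\in\rho_\phi(M)$. -/

import Mathlib

open FirstOrder

universe u v w

namespace SymbolicImage

/-- The binary `ℤ`-sequence with value `1` at every `i ≤ 0` and value `0` at every `i > 0`.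
The space of binary `ℤ`-sequences is `ℤ → Bool` (with `true` as `1`), with the product topology. -/
def oneZero : ℤ → Bool := fun i => decide (i ≤ 0)

/-- The binary `ℤ`-sequence `I` contains the block `J (-n), …, J n` as a string of
consecutive terms, at some place. -/
def ContainsBlock (I J : ℤ → Bool) (n : ℕ) : Prop :=
  ∃ k : ℤ, ∀ i : ℤ, -(n : ℤ) ≤ i → i ≤ n → I (k + i) = J i

section Structures

variable {L : FirstOrder.Language.{u, v}} {M : Type w} [L.Structure M]

/-- The coordinatewise action of the integer power `σ ^ i` of an automorphism `σ` on tuples. -/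
def autPow {k : ℕ} (σ : M ≃[L] M) (i : ℤ) (a : Fin k → M) : Fin k → M :=
  fun j => ((σ.toEquiv : Equiv.Perm M) ^ i) (a j)

/-- The instance `φ(M, b)` of `φ(x, y)`: the tuples `a` with `M ⊨ φ(a, b)`. -/
def instanceSet {m n : ℕ} (φ : L.Formula (Fin m ⊕ Fin n)) (b : Fin n → M) :
    Set (Fin m → M) :=
  {a | φ.Realize (Sum.elim a b)}

/-- The symbolic representation `ξ_{σ,U}`: it maps `a` to (the indicator function of)
`{i ∈ ℤ | σ ^ i (a) ∈ U}`. -/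
noncomputable def symbolicRep {m : ℕ} (σ : M ≃[L] M) (U : Set (Fin m → M)) (a : Fin m → M) :
    ℤ → Bool :=
  fun i => U.boolIndicator (autPow σ i a)

/-- A sequence of `n`-tuples, indexed by a linear order, is indiscernible (over the empty set):
any two increasing finite subsequences of the same length satisfy the same formulas. -/
def IsIndiscernible (L : FirstOrder.Language.{u, v}) {M : Type w} [L.Structure M]
    {ι : Type*} [LinearOrder ι] {n : ℕ} (c : ι → Fin n → M) : Prop :=
  ∀ (k : ℕ) (ψ : L.Formula (Fin k × Fin n)) (s t : Fin k → ι), StrictMono s → StrictMono t →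
    (ψ.Realize (fun p => c (s p.1) p.2) ↔ ψ.Realize (fun p => c (t p.1) p.2))

/-- `W_b`: the automorphisms `σ` of `M` whose orbit `(σ ^ i (b))_{i ∈ ℤ}` of `b` is an
indiscernible sequence. -/
def indiscernibleAut {n : ℕ} (b : Fin n → M) : Set (M ≃[L] M) :=
  {σ | IsIndiscernible L (fun i : ℤ => autPow σ i b)}

/-- The total symbolic image `ρ_φ(M)`, the union of the sets `ξ_{σ,φ(M,b)}(M)` over all
parameters `b` and all automorphisms `σ` of `M`. -/
def totalSymbolicImage {m n : ℕ} (φ : L.Formula (Fin m ⊕ Fin n)) (M : Type w) [L.Structure M] :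
    Set (ℤ → Bool) :=
  ⋃ (b : Fin n → M) (σ : M ≃[L] M), Set.range (symbolicRep σ (instanceSet φ b))

end Structures

/-- `φ(x, y)` has the order property with respect to `T`, witnessed in a model in `Type w`. -/
def HasOrderProperty {L : FirstOrder.Language.{u, v}} (T : L.Theory) {m n : ℕ}
    (φ : L.Formula (Fin m ⊕ Fin n)) : Prop :=
  ∃ M : FirstOrder.Language.Theory.ModelType.{u, v, w} T, ∀ N : ℕ,
    ∃ (a : Fin N → Fin m → M) (b : Fin N → Fin n → M),
      ∀ i j : Fin N, φ.Realize (Sum.elim (a i) (b j)) ↔ i ≤ j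

end SymbolicImage

open SymbolicImage

namespace SymbolicImage

/-! The real content is that the order property yields an automorphism with an indiscernible orbit
coding the order of `ℤ`; the other implications are elementary. An ultrapower turns the finite
witnesses into infinite sequences with `φ(a_i, b_j)` iff `i ≤ j`. Next, iterating a nonprincipal
ultrafilter on `ℕ` along `ℤ` gives an ultrafilter on `ℤ → ℕ` whose restrictions to finite index sets
depend only on their size. It is therefore shift invariant on conditions involving finitely many
coordinates, though not obviously on all sets. Hence the shift is made to act only on the ultrapower
classes of functions of finitely many coordinates, which form an elementary substructure. There the
classes of `x ↦ b (x i)` form an indiscernible orbit, and `φ` between the classes of `a (x i)` and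
`b (x 0)` says `x i ≤ x 0` almost everywhere, i.e. `i ≤ 0`. Conversely, a long block of ones
followed by zeros gives a half-graph by translating `a` and `b` along `σ`. -/

open Filter

/-! ### Iterated ultrafilters and their shift invariance -/

/-- The `l`-th tensor power of a nonprincipal ultrafilter on `ℕ`, as an ultrafilter on sequences
which vanish from the `l`-th term on. -/
noncomputable def tensorPower : ℕ → Ultrafilter (ℕ → ℕ)
  | 0 => pure 0
  | l + 1 => (tensorPower l).bind fun x => (hyperfilter ℕ).map (Function.update x l)

theorem eventually_tensorPower_succ {l : ℕ} {p : (ℕ → ℕ) → Prop} :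
    (∀ᶠ x in tensorPower (l + 1), p x) ↔
      ∀ᶠ x in tensorPower l, ∀ᶠ r in hyperfilter ℕ, p (Function.update x l r) :=
  Iff.rfl

/-- The innermost quantifier governs the largest index. If `s` hits that index, it does so with its
last term, and one quantifier is peeled off both sides; otherwise the quantifier is vacuous. -/
theorem eventually_tensorPower_comp {k l : ℕ} {s : Fin k → ℕ} (hs : StrictMono s)
    (hl : ∀ i, s i < l) (p : (Fin k → ℕ) → Prop) :
    (∀ᶠ x in tensorPower l, p (x ∘ s)) ↔ ∀ᶠ x in tensorPower k, p (x ∘ Fin.val) := by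
  induction l generalizing k with
  | zero =>
    have : k = 0 := by
      rcases k with _ | k
      · rfl
      · exact absurd (hl 0) (by omega)
    subst this
    have : s = Fin.val := Subsingleton.elim _ _
    rw [this]
  | succ l ih =>
    rw [eventually_tensorPower_succ]
    by_cases h : ∃ i, s i = l
    · obtain ⟨i, hi⟩ := h
      obtain ⟨k, rfl⟩ : ∃ k', k = k' + 1 := ⟨k - 1, by have := i.2; omega⟩
      have hlast : s (Fin.last k) = l :=
        le_antisymm (Nat.lt_succ_iff.1 (hl _)) (hi ▸ hs.monotone (Fin.le_last i))
      have hlt : ∀ j : Fin k, s j.castSucc < l := fun j =>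
        hlast ▸ hs (Fin.castSucc_lt_last j)
      have h1 : ∀ (x : ℕ → ℕ) (r : ℕ), Function.update x l r ∘ s =
          Fin.snoc (x ∘ s ∘ Fin.castSucc) r := by
        intro x r
        ext j
        refine Fin.lastCases ?_ (fun j => ?_) j
        · simp [hlast]
        · simp [(hlt j).ne]
      have h2 : ∀ (x : ℕ → ℕ) (r : ℕ), Function.update x k r ∘ (Fin.val : Fin (k + 1) → ℕ) =
          Fin.snoc (x ∘ (Fin.val : Fin k → ℕ)) r := by
        intro x r
        ext j
        refine Fin.lastCases ?_ (fun j => ?_) j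
        · simp
        · simp [j.2.ne]
      rw [eventually_tensorPower_succ]
      simp only [h1, h2]
      exact ih (s := s ∘ Fin.castSucc) (hs.comp Fin.strictMono_castSucc) hlt
        (fun y => ∀ᶠ r in hyperfilter ℕ, p (Fin.snoc y r))
    · push Not at h
      have h1 : ∀ (x : ℕ → ℕ) (r : ℕ), Function.update x l r ∘ s = x ∘ s := by
        intro x r
        ext j
        simp [h j]
      simp only [h1, eventually_const]
      exact ih hs (fun i => lt_of_le_of_ne (Nat.lt_succ_iff.1 (hl i)) (h i)) p

/-- An ultrafilter on `ℤ → ℕ` all of whose images under restriction to finite sets of indices are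
tensor powers of the same nonprincipal ultrafilter. -/
noncomputable def intTensorPower : Ultrafilter (ℤ → ℕ) :=
  (hyperfilter ℕ).bind fun r =>
    (tensorPower (2 * r)).map fun (x : ℕ → ℕ) (i : ℤ) => x (i + r).toNat

/-- For large `r` the window `[-r, r)` contains the range of `s`, and translating by `r` reduces to
the case of indices in `ℕ`; the truncation by `toNat` then plays no role. -/
theorem eventually_intTensorPower_comp {k : ℕ} {s : Fin k → ℤ} (hs : StrictMono s)
    (p : (Fin k → ℕ) → Prop) :
    (∀ᶠ x in intTensorPower, p (x ∘ s)) ↔ ∀ᶠ x in tensorPower k, p (x ∘ Fin.val) := by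
  have hev : ∀ᶠ r : ℕ in (hyperfilter ℕ : Filter ℕ), ∀ i, (s i).natAbs < r :=
    eventually_all.2 fun i => Nat.hyperfilter_le_atTop (eventually_gt_atTop _)
  have key : ∀ᶠ r : ℕ in (hyperfilter ℕ : Filter ℕ),
      ((∀ᶠ x : ℕ → ℕ in tensorPower (2 * r), p ((fun i : ℤ => x (i + r).toNat) ∘ s)) ↔
        ∀ᶠ x in tensorPower k, p (x ∘ Fin.val)) := by
    filter_upwards [hev] with r hr
    refine eventually_tensorPower_comp (s := fun i => (s i + r).toNat) ?_ ?_ p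
    · intro i j hij
      have := hs hij
      have := hr i
      have := hr j
      simp only
      omega
    · intro i
      have := hr i
      omega
  calc (∀ᶠ x in intTensorPower, p (x ∘ s)) ↔ ∀ᶠ r : ℕ in (hyperfilter ℕ : Filter ℕ),
        ∀ᶠ x : ℕ → ℕ in tensorPower (2 * r), p ((fun i : ℤ => x (i + r).toNat) ∘ s) := Iff.rfl
    _ ↔ ∀ᶠ r : ℕ in (hyperfilter ℕ : Filter ℕ), ∀ᶠ x in tensorPower k, p (x ∘ Fin.val) :=
        eventually_congr key
    _ ↔ _ := eventually_const

theorem eventually_intTensorPower_shift {q : (ℤ → ℕ) → Prop} {F : Finset ℤ}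
    (hq : DependsOn q (F : Set ℤ)) (k : ℤ) :
    (∀ᶠ x : ℤ → ℕ in intTensorPower, q fun i => x (i + k)) ↔ ∀ᶠ x in intTensorPower, q x := by
  let s : Fin F.card → ℤ := F.orderEmbOfFin rfl
  have hs : StrictMono s := (F.orderEmbOfFin rfl).strictMono
  -- The value `0` off `F` is arbitrary, since `q` ignores those coordinates.
  let p : (Fin F.card → ℕ) → Prop := fun y => q (Function.extend s y 0)
  have hp : ∀ x : ℤ → ℕ, q x = p (x ∘ s) := by
    intro x
    refine hq fun i hi => ?_
    obtain ⟨j, rfl⟩ : i ∈ Set.range s := by simpa [s] using hi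
    rw [hs.injective.extend_apply, Function.comp]
  simp only [hp]
  rw [eventually_intTensorPower_comp hs]
  exact eventually_intTensorPower_comp (s := fun i => s i + k) (fun i j h => by
    simpa using hs h) p

/-- The later coordinate is chosen after the earlier one, and a nonprincipal ultrafilter contains
every final segment of `ℕ`. -/
theorem eventually_intTensorPower_lt {i j : ℤ} (h : i < j) :
    ∀ᶠ x : ℤ → ℕ in intTensorPower, x i < x j := by
  have hs : StrictMono ![i, j] := by
    rw [Fin.strictMono_iff_lt_succ]
    intro a
    fin_cases a
    simpa using h
  have := (eventually_intTensorPower_comp hs fun y => y 0 < y 1).2 <| by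
    rw [eventually_tensorPower_succ]
    refine Eventually.of_forall fun x => ?_
    filter_upwards [Nat.hyperfilter_le_atTop (eventually_gt_atTop (x 0))] with r hr
    simpa using hr
  simpa using this

/-! ### The elementary substructure of finitely supported classes and its shift -/

section Shift

variable {L : FirstOrder.Language.{u, v}} {M : Type w} [L.Structure M]

/-- The function depends on finitely many coordinates only. -/
def FinitelySupported {β : Type*} (f : (ℤ → ℕ) → β) : Prop :=
  ∃ F : Finset ℤ, DependsOn f (F : Set ℤ)

theorem FinitelySupported.pi {k : ℕ} {β : Type*} {f : Fin k → (ℤ → ℕ) → β}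
    (hf : ∀ i, FinitelySupported (f i)) : FinitelySupported fun x i => f i x := by
  classical
  choose F hF using hf
  refine ⟨Finset.univ.biUnion F, fun x y h => funext fun i => hF i fun j hj => h j ?_⟩
  exact Finset.mem_coe.2 (Finset.mem_biUnion.2 ⟨i, Finset.mem_univ i, hj⟩)

theorem FinitelySupported.comp {β γ : Type*} {f : (ℤ → ℕ) → β} (hf : FinitelySupported f)
    (g : β → γ) : FinitelySupported fun x => g (f x) := by
  obtain ⟨F, hF⟩ := hf
  exact ⟨F, fun x y h => congrArg g (hF h)⟩

theorem FinitelySupported.comp₂ {β γ δ : Type*} {f : (ℤ → ℕ) → β} {g : (ℤ → ℕ) → γ}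
    (hf : FinitelySupported f) (hg : FinitelySupported g) (h : β → γ → δ) :
    FinitelySupported fun x => h (f x) (g x) := by
  classical
  obtain ⟨F, hF⟩ := hf
  obtain ⟨G, hG⟩ := hg
  refine ⟨F ∪ G, fun x y hxy => ?_⟩
  have h1 : f x = f y := hF fun j hj => hxy j (by simp_all)
  have h2 : g x = g y := hG fun j hj => hxy j (by simp_all)
  simp only [h1, h2]

theorem FinitelySupported.shift {β : Type*} {f : (ℤ → ℕ) → β} (hf : FinitelySupported f)
    (k : ℤ) : FinitelySupported fun x => f fun i => x (i + k) := by
  obtain ⟨F, hF⟩ := hf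
  refine ⟨F.image (· + k), fun x y h => hF fun i hi => h _ ?_⟩
  exact Finset.mem_coe.2 (Finset.mem_image_of_mem _ hi)

theorem FinitelySupported.eventually_shift {q : (ℤ → ℕ) → Prop} (hq : FinitelySupported q)
    (k : ℤ) :
    (∀ᶠ x : ℤ → ℕ in intTensorPower, q fun i => x (i + k)) ↔ ∀ᶠ x in intTensorPower, q x :=
  hq.elim fun _ hF => eventually_intTensorPower_shift hF k

variable (M) in
/-- The ultrapower of `M` by `intTensorPower`. -/
abbrev IntPower : Type w := (intTensorPower : Filter (ℤ → ℕ)).Product fun _ => M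

/-- The class of a function in the ultrapower. -/
noncomputable def IntPower.mk (f : (ℤ → ℕ) → M) : IntPower M :=
  Quotient.mk ((intTensorPower : Filter (ℤ → ℕ)).productSetoid fun _ => M) f

theorem IntPower.mk_eq {f g : (ℤ → ℕ) → M} :
    IntPower.mk f = IntPower.mk g ↔ ∀ᶠ x in intTensorPower, f x = g x :=
  Quotient.eq

theorem IntPower.realize_mk [Nonempty M] {β : Type*} (ψ : L.Formula β) (f : β → (ℤ → ℕ) → M) :
    (ψ.Realize fun i => IntPower.mk (f i)) ↔
      ∀ᶠ x in intTensorPower, ψ.Realize fun i => f i x :=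
  Language.Ultraproduct.realize_formula_cast ψ f

theorem IntPower.realize_mk_boundedFormula [Nonempty M] {β : Type*} {k : ℕ}
    (ψ : L.BoundedFormula β k) (f : β → (ℤ → ℕ) → M) (g : Fin k → (ℤ → ℕ) → M) :
    (ψ.Realize (fun i => IntPower.mk (f i)) fun i => IntPower.mk (g i)) ↔
      ∀ᶠ x in intTensorPower, ψ.Realize (fun i => f i x) fun i => g i x :=
  Language.Ultraproduct.boundedFormula_realize_cast ψ f g

theorem IntPower.funMap_mk {k : ℕ} (F : L.Functions k) (f : Fin k → (ℤ → ℕ) → M) :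
    (Language.Structure.funMap F fun i => IntPower.mk (f i)) =
      IntPower.mk fun x => Language.Structure.funMap F fun i => f i x :=
  Language.Ultraproduct.funMap_cast F f

theorem IntPower.relMap_mk {k : ℕ} (R : L.Relations k) (f : Fin k → (ℤ → ℕ) → M) :
    (Language.Structure.RelMap R fun i => IntPower.mk (f i)) ↔
      ∀ᶠ x in intTensorPower, Language.Structure.RelMap R fun i => f i x :=
  Language.relMap_quotient_mk' (s := (intTensorPower : Filter (ℤ → ℕ)).productSetoid fun _ => M) R f

variable (L M) in
/-- The classes of the finitely supported functions. -/
def finiteSupport : L.Substructure (IntPower M) where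
  carrier := {z | ∃ f : (ℤ → ℕ) → M, FinitelySupported f ∧ IntPower.mk f = z}
  fun_mem := by
    intro k F z hz
    choose f hf hfz using hz
    obtain rfl : (fun i => IntPower.mk (f i)) = z := funext hfz
    exact ⟨_, (FinitelySupported.pi hf).comp _, (IntPower.funMap_mk F f).symm⟩

theorem exists_mk_eq (z : finiteSupport L M) :
    ∃ f : (ℤ → ℕ) → M, FinitelySupported f ∧ IntPower.mk f = z :=
  z.2

/-- Tarski–Vaught test: a pointwise Skolem function applied to finitely supported parameters is
again finitely supported. -/
theorem finiteSupport_isElementary [Nonempty M] : (finiteSupport L M).IsElementary := by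
  refine Language.Substructure.isElementary_of_exists _ fun k ψ z a h => ?_
  choose f hf hfz using fun i => exists_mk_eq (z i)
  obtain ⟨g, rfl⟩ : ∃ g, IntPower.mk g = a := Quotient.exists_rep a
  have hsnoc : ∀ g : (ℤ → ℕ) → M, (Fin.snoc ((↑) ∘ z) (IntPower.mk g) : Fin (k + 1) → IntPower M) =
      fun i => IntPower.mk ((Fin.snoc f g : Fin (k + 1) → (ℤ → ℕ) → M) i) := by
    intro g
    ext i
    refine Fin.lastCases ?_ (fun i => ?_) i
    · simp
    · simp [hfz]
  have hreal : ∀ g : (ℤ → ℕ) → M,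
      (ψ.Realize default (Fin.snoc ((↑) ∘ z) (IntPower.mk g) : Fin (k + 1) → IntPower M) ↔
        ∀ᶠ x in intTensorPower, ψ.Realize default (Fin.snoc (fun i => f i x) (g x))) := by
    intro g
    rw [hsnoc]
    have h1 := IntPower.realize_mk_boundedFormula ψ (fun e : Empty => e.elim)
      (Fin.snoc f g : Fin (k + 1) → (ℤ → ℕ) → M)
    have h2 : ∀ x, (fun i => (Fin.snoc f g : Fin (k + 1) → (ℤ → ℕ) → M) i x) =
        (Fin.snoc (fun i => f i x) (g x) : Fin (k + 1) → M) := by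
      intro x
      ext i
      refine Fin.lastCases ?_ (fun i => ?_) i
      · simp
      · simp
    simp only [h2] at h1
    convert! h1 using 2
    exact funext fun x => congrArg (fun e => ψ.Realize e _) (Subsingleton.elim _ _)
  let w : (Fin k → M) → M := fun y =>
    Classical.epsilon fun c : M => ψ.Realize default (Fin.snoc y c)
  have hw : FinitelySupported fun x => w fun i => f i x := (FinitelySupported.pi hf).comp w
  refine ⟨⟨IntPower.mk _, _, hw, rfl⟩, (hreal _).2 ?_⟩
  filter_upwards [(hreal g).1 h] with x hx
  exact Classical.epsilon_spec (p := fun c : M => ψ.Realize default (Fin.snoc (fun i => f i x) c))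
    ⟨_, hx⟩

/-- The element of `finiteSupport` given by a finitely supported function. -/
noncomputable def finMk {f : (ℤ → ℕ) → M} (hf : FinitelySupported f) : finiteSupport L M :=
  ⟨IntPower.mk f, f, hf, rfl⟩

theorem finMk_eq {f g : (ℤ → ℕ) → M} {hf : FinitelySupported f} {hg : FinitelySupported g} :
    (finMk hf : finiteSupport L M) = finMk hg ↔ ∀ᶠ x in intTensorPower, f x = g x :=
  Subtype.ext_iff.trans IntPower.mk_eq

theorem exists_finMk_eq (z : finiteSupport L M) :
    ∃ (f : (ℤ → ℕ) → M) (hf : FinitelySupported f), finMk hf = z :=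
  let ⟨f, hf, h⟩ := z.2
  ⟨f, hf, Subtype.ext h⟩

/-- The translation by `k` of the index set `ℤ`, as a map of `finiteSupport`. -/
noncomputable def shiftFun (k : ℤ) (z : finiteSupport L M) : finiteSupport L M :=
  finMk ((exists_mk_eq z).choose_spec.1.shift k)

/-- Independence of the chosen representative: agreement of two finitely supported functions is a
finitely supported condition, so its truth almost everywhere survives the shift. -/
theorem shiftFun_finMk (k : ℤ) {f : (ℤ → ℕ) → M} (hf : FinitelySupported f) :
    shiftFun k (finMk hf : finiteSupport L M) = finMk (hf.shift k) := by
  have h := (exists_mk_eq (finMk hf : finiteSupport L M)).choose_spec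
  exact finMk_eq.2 <| ((h.1.comp₂ hf (· = ·)).eventually_shift k).2 (IntPower.mk_eq.1 h.2)

theorem shiftFun_shiftFun {k l : ℤ} (h : l + k = 0) (z : finiteSupport L M) :
    shiftFun k (shiftFun l z) = z := by
  obtain ⟨f, hf, rfl⟩ := exists_finMk_eq z
  rw [shiftFun_finMk, shiftFun_finMk, finMk_eq]
  exact Eventually.of_forall fun x => by simp [add_assoc, h]

variable (L M) in
/-- The translation by `1` of the index set `ℤ`, as an automorphism of `finiteSupport`. -/
noncomputable def shiftEquiv : finiteSupport L M ≃[L] finiteSupport L M where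
  toFun := shiftFun 1
  invFun := shiftFun (-1)
  left_inv := shiftFun_shiftFun (by simp)
  right_inv := shiftFun_shiftFun (by simp)
  map_fun' := by
    intro k F z
    choose f hf hz using fun i => exists_finMk_eq (z i)
    obtain rfl : (fun i => finMk (hf i)) = z := funext hz
    have h : ∀ {g : Fin k → (ℤ → ℕ) → M} (hg : ∀ i, FinitelySupported (g i)),
        Language.Structure.funMap F (fun i => (finMk (hg i) : finiteSupport L M)) =
          finMk ((FinitelySupported.pi hg).comp (Language.Structure.funMap F)) :=
      fun {g} hg => Subtype.ext (IntPower.funMap_mk F g)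
    simp only [Function.comp_def, h, shiftFun_finMk]
  map_rel' := by
    intro k R z
    choose f hf hz using fun i => exists_finMk_eq (z i)
    obtain rfl : (fun i => finMk (hf i)) = z := funext hz
    have h : ∀ {g : Fin k → (ℤ → ℕ) → M} (hg : ∀ i, FinitelySupported (g i)),
        Language.Structure.RelMap R (fun i => (finMk (hg i) : finiteSupport L M)) ↔
          ∀ᶠ x in intTensorPower, Language.Structure.RelMap R fun i => g i x :=
      fun {g} hg => IntPower.relMap_mk R g
    simp only [Function.comp_def, shiftFun_finMk, h]
    exact ((FinitelySupported.pi hf).comp (Language.Structure.RelMap R)).eventually_shift 1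

/-- The class of `x ↦ c (x i)`. -/
noncomputable def coordinate (c : ℕ → M) (i : ℤ) : finiteSupport L M :=
  finMk (f := fun x => c (x i)) ⟨{i}, fun x y h => congrArg c (h i (by simp))⟩

theorem shiftEquiv_zpow_coordinate (c : ℕ → M) (i j : ℤ) :
    ((shiftEquiv L M).toEquiv ^ i : Equiv.Perm (finiteSupport L M)) (coordinate c j) =
      coordinate c (j + i) := by
  have h1 : ∀ j, ((shiftEquiv L M).toEquiv : Equiv.Perm (finiteSupport L M)) (coordinate c j) =
      coordinate c (j + 1) := fun j => shiftFun_finMk 1 _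
  induction i generalizing j with
  | zero => simp
  | succ i ih => rw [zpow_add_one, Equiv.Perm.mul_apply, h1, ih]; congr 1; ring
  | pred i ih =>
    rw [zpow_sub_one, Equiv.Perm.mul_apply, Equiv.Perm.inv_eq_iff_eq.2
      (by rw [h1, sub_add_cancel] : coordinate c j = _ ), ih]
    congr 1; ring

theorem realize_coordinate [Nonempty M] {β : Type*} (ψ : L.Formula β) (c : β → ℕ → M)
    (i : β → ℤ) :
    (ψ.Realize fun p => (coordinate (c p) (i p) : finiteSupport L M)) ↔
      ∀ᶠ x : ℤ → ℕ in intTensorPower, ψ.Realize fun p => c p (x (i p)) := by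
  rw [← IntPower.realize_mk ψ fun p x => c p (x (i p))]
  let S : L.ElementarySubstructure (IntPower M) := ⟨_, finiteSupport_isElementary⟩
  exact (S.subtype.map_formula ψ fun p => (coordinate (c p) (i p) : finiteSupport L M)).symm

end Shift

/-! ### From the order property to an indiscernible orbit -/

theorem HasOrderProperty.exists_sequence {L : FirstOrder.Language.{u, v}} {T : L.Theory}
    {m n : ℕ} {φ : L.Formula (Fin m ⊕ Fin n)} (h : HasOrderProperty.{u, v, w} T φ) :
    ∃ (M : FirstOrder.Language.Theory.ModelType.{u, v, w} T) (a : ℕ → Fin m → M)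
      (b : ℕ → Fin n → M), ∀ i j, φ.Realize (Sum.elim (a i) (b j)) ↔ i ≤ j := by
  obtain ⟨M, hM⟩ := h
  -- Length `N + 1` makes the index type nonempty, so that `Fin.ofNat` is available; its reduction
  -- modulo `r + 1` is harmless once `r ≥ max i j`.
  choose a b hab using fun N => hM (N + 1)
  let N : Type w := (hyperfilter ℕ : Filter ℕ).Product fun _ => M
  have hN : N ⊨ T := by
    refine ⟨fun ψ hψ => (Language.Ultraproduct.sentence_realize ψ).2 ?_⟩
    exact Eventually.of_forall fun _ => M.is_model.realize_of_mem ψ hψ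
  have : Nonempty N := Language.Ultraproduct.Product.instNonempty
  let mk : (ℕ → M) → N :=
    Quotient.mk ((hyperfilter ℕ : Filter ℕ).productSetoid fun _ => M)
  refine ⟨Language.Theory.ModelType.of T N, fun i p => mk fun r => a r (Fin.ofNat _ i) p,
    fun j p => mk fun r => b r (Fin.ofNat _ j) p, fun i j => ?_⟩
  have h1 := Language.Ultraproduct.realize_formula_cast (u := hyperfilter ℕ) φ
    (Sum.elim (fun p r => a r (Fin.ofNat (r + 1) i) p) fun p r => b r (Fin.ofNat (r + 1) j) p)
  have h2 : ∀ᶠ r in (hyperfilter ℕ : Filter ℕ),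
      (φ.Realize (fun p => Sum.elim (fun p r => a r (Fin.ofNat (r + 1) i) p)
        (fun p r => b r (Fin.ofNat (r + 1) j) p) p r) ↔ i ≤ j) := by
    filter_upwards [Nat.hyperfilter_le_atTop (eventually_ge_atTop (max i j))] with r hr
    have hi : i < r + 1 := by omega
    have hj : j < r + 1 := by omega
    have := hab r (Fin.ofNat (r + 1) i) (Fin.ofNat (r + 1) j)
    simp only [Fin.le_def, Fin.val_ofNat, Nat.mod_eq_of_lt hi, Nat.mod_eq_of_lt hj] at this
    rw [← this]
    refine iff_of_eq (congrArg _ (funext fun p => ?_))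
    cases p <;> rfl
  rw [eventually_congr h2, eventually_const] at h1
  rw [← h1]
  refine iff_of_eq (congrArg (φ.Realize (M := N)) (funext fun p => ?_))
  cases p <;> rfl

theorem HasOrderProperty.exists_symbolicRep_eq {L : FirstOrder.Language.{u, v}} {T : L.Theory}
    {m n : ℕ} {φ : L.Formula (Fin m ⊕ Fin n)} (h : HasOrderProperty.{u, v, w} T φ) :
    ∃ (M : FirstOrder.Language.Theory.ModelType.{u, v, w} T)
      (b : Fin n → M) (σ : M ≃[L] M) (a : Fin m → M),
      symbolicRep σ (instanceSet φ b) a = oneZero ∧ σ ∈ indiscernibleAut b := by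
  obtain ⟨M, a, b, hab⟩ := h.exists_sequence
  let S : L.ElementarySubstructure (IntPower M) := ⟨_, finiteSupport_isElementary⟩
  have hT : IntPower M ⊨ T := by
    refine ⟨fun ψ hψ => (Language.Ultraproduct.sentence_realize ψ).2 ?_⟩
    exact Eventually.of_forall fun _ => M.is_model.realize_of_mem ψ hψ
  have : Nonempty (IntPower M) := Language.Ultraproduct.Product.instNonempty
  have hS : finiteSupport L M ⊨ T := (S.theory_model_iff T).2 hT
  have hS' : Nonempty (finiteSupport L M) := ⟨coordinate (fun i => Classical.arbitrary M) 0⟩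
  refine ⟨Language.Theory.ModelType.of T (finiteSupport L M),
    fun p => coordinate (fun r => b r p) 0, shiftEquiv L M,
    fun p => coordinate (fun r => a r p) 0, ?_, ?_⟩
  · funext i
    have h1 : autPow (shiftEquiv L M) i (fun p => coordinate (fun r => a r p) 0) ∈
        instanceSet φ (fun p => (coordinate (fun r => b r p) 0 : finiteSupport L M)) ↔ i ≤ 0 := by
      have h2 := realize_coordinate (M := M) φ (Sum.elim (fun p r => a r p) fun p r => b r p)
        (Sum.elim (fun _ => i) fun _ => 0)
      have h3 : ∀ x : ℤ → ℕ, φ.Realize (fun p : Fin m ⊕ Fin n =>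
          (Sum.elim (fun p r => a r p) (fun p r => b r p) p : ℕ → M)
            (x ((Sum.elim (fun _ => i) fun _ => 0 : Fin m ⊕ Fin n → ℤ) p))) ↔ x i ≤ x 0 := by
        intro x
        rw [← hab]
        refine iff_of_eq (congrArg _ (funext fun p => ?_))
        cases p <;> rfl
      simp only [h3] at h2
      have h4 : (∀ᶠ x : ℤ → ℕ in intTensorPower, x i ≤ x 0) ↔ i ≤ 0 := by
        refine ⟨fun h => ?_, fun h => ?_⟩
        · by_contra! hi
          obtain ⟨x, hx, hx'⟩ := (h.and (eventually_intTensorPower_lt hi)).exists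
          exact absurd hx (not_le.2 hx')
        · rcases h.lt_or_eq with h | rfl
          · exact (eventually_intTensorPower_lt h).mono fun x hx => hx.le
          · exact Eventually.of_forall fun x => le_rfl
      rw [h4] at h2
      rw [← h2, instanceSet, Set.mem_ofPred_eq]
      refine iff_of_eq (congrArg _ (funext fun p => ?_))
      rcases p with p | p
      · exact (shiftEquiv_zpow_coordinate _ i 0).trans (by rw [zero_add]; rfl)
      · rfl
    by_cases hi : i ≤ 0
    · exact ((Set.mem_iff_boolIndicator _ _).1 (h1.2 hi)).trans (by simp [oneZero, hi])
    · exact ((Set.notMem_iff_boolIndicator _ _).1 (fun h => hi (h1.1 h))).trans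
        (by simp [oneZero, hi])
  -- Indiscernibility: the right-hand side does not mention `s`.
  · have h1 : ∀ (k : ℕ) (ψ : L.Formula (Fin k × Fin n)) (s : Fin k → ℤ), StrictMono s →
        (ψ.Realize (fun p => autPow (shiftEquiv L M) (s p.1)
          (fun p => coordinate (fun r => b r p) 0) p.2) ↔
        ∀ᶠ x : ℕ → ℕ in tensorPower k, ψ.Realize fun p => b (x p.1) p.2) := by
      intro k ψ s hs
      have h2 := realize_coordinate (M := M) ψ (fun p r => b r p.2) fun p => s p.1
      have h3 := eventually_intTensorPower_comp hs fun y => ψ.Realize fun p => b (y p.1) p.2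
      refine Iff.trans ?_ (h2.trans h3)
      refine iff_of_eq (congrArg _ (funext fun p => ?_))
      exact (shiftEquiv_zpow_coordinate _ (s p.1) 0).trans (by rw [zero_add])
    exact fun k ψ s t hs ht => (h1 k ψ s hs).trans (h1 k ψ t ht).symm

/-! ### From blocks and closures back to the order property -/

theorem realize_comp_zpow {L : FirstOrder.Language.{u, v}} {M : Type w} [L.Structure M]
    {β : Type*} (σ : M ≃[L] M) (ψ : L.Formula β) (i : ℤ) (c : β → M) :
    (ψ.Realize fun p => (σ.toEquiv ^ i : Equiv.Perm M) (c p)) ↔ ψ.Realize c := by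
  have h1 : ∀ c : β → M,
      (ψ.Realize fun p => (σ.toEquiv : Equiv.Perm M) (c p)) ↔ ψ.Realize c :=
    fun c => Language.StrongHomClass.realize_formula σ ψ
  induction i generalizing c with
  | zero => simp
  | succ i ih =>
    simp only [zpow_add_one, Equiv.Perm.mul_apply]
    exact (ih _).trans (h1 c)
  | pred i ih =>
    simp only [zpow_sub_one, Equiv.Perm.mul_apply]
    refine (ih _).trans ((h1 _).symm.trans (iff_of_eq ?_))
    exact congrArg ψ.Realize (funext fun p => Equiv.apply_symm_apply _ (c p))

theorem symbolicRep_eq_true {L : FirstOrder.Language.{u, v}} {M : Type w} [L.Structure M]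
    {m : ℕ} {σ : M ≃[L] M} {U : Set (Fin m → M)} {a : Fin m → M} {i : ℤ} :
    symbolicRep σ U a i = true ↔ autPow σ i a ∈ U :=
  (Set.mem_iff_boolIndicator _ _).symm

theorem HasOrderProperty.of_containsBlock {L : FirstOrder.Language.{u, v}} {T : L.Theory}
    {m n : ℕ} {φ : L.Formula (Fin m ⊕ Fin n)}
    (M : FirstOrder.Language.Theory.ModelType.{u, v, w} T) (σ : M ≃[L] M)
    (h : ∀ N : ℕ, ∃ b : Fin n → M, ∃ I ∈ Set.range (symbolicRep σ (instanceSet φ b)),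
      ContainsBlock I oneZero N) : HasOrderProperty.{u, v, w} T φ := by
  refine ⟨M, fun N => ?_⟩
  obtain ⟨b, _, ⟨a, rfl⟩, k, hk⟩ := h N
  -- Applying `σ ^ (-j)`, `φ` at the pair `(i, j)` reads off position `k + (i - j)` of the sequence
  -- of `a`, which lies in the block because `|i - j| < N`.
  refine ⟨fun i => autPow σ (k + i) a, fun j => autPow σ j b, fun i j => ?_⟩
  have h1 := hk ((i : ℕ) - (j : ℕ)) (by omega) (by omega)
  have h2 : autPow σ (k + ((i : ℕ) - (j : ℕ))) a ∈ instanceSet φ b ↔ i ≤ j := by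
    rw [← symbolicRep_eq_true, h1]
    simp [oneZero]
  rw [← h2, instanceSet, Set.mem_ofPred_eq,
    ← realize_comp_zpow σ φ j (Sum.elim (autPow σ _ a) b)]
  refine iff_of_eq (congrArg _ (funext fun p => ?_))
  rcases p with p | p
  · simp only [Sum.elim_inl, autPow, ← Equiv.Perm.mul_apply, ← zpow_add]
    congr 2
    ring
  · rfl

/-- Prescribing the coordinates from `-N` to `N` is an open condition, so a point of `A` meets it,
with the block at place `0`. -/
theorem containsBlock_oneZero_of_mem_closure {A : Set (ℤ → Bool)} (h : oneZero ∈ closure A)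
    (N : ℕ) : ∃ I ∈ A, ContainsBlock I oneZero N := by
  have hopen : IsOpen {I : ℤ → Bool | ∀ i ∈ Set.Icc (-(N : ℤ)) N, I i = oneZero i} := by
    simp only [Set.ofPred_forall]
    exact (Set.finite_Icc _ _).isOpen_biInter fun i _ =>
      (isOpen_discrete {y | y = oneZero i}).preimage
        (f := fun I : ℤ → Bool => I i) (continuous_apply i)
  obtain ⟨I, hI, hIA⟩ := mem_closure_iff.1 h _ hopen fun _ _ => rfl
  exact ⟨I, hIA, 0, fun i h1 h2 => by rw [zero_add]; exact hI i ⟨h1, h2⟩⟩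

end SymbolicImage

theorem mainTheorem7 {L : FirstOrder.Language.{u, v}} (T : L.Theory) {m n : ℕ}
    (φ : L.Formula (Fin m ⊕ Fin n)) :
    List.TFAE [
      HasOrderProperty.{u, v, max u v w} T φ,
      ∃ (M : FirstOrder.Language.Theory.ModelType.{u, v, max u v w} T)
        (b : Fin n → M) (σ : M ≃[L] M) (a : Fin m → M),
        symbolicRep σ (instanceSet φ b) a = oneZero,
      ∃ (M : FirstOrder.Language.Theory.ModelType.{u, v, max u v w} T)
        (b : Fin n → M) (σ : M ≃[L] M) (a : Fin m → M),
        symbolicRep σ (instanceSet φ b) a = oneZero ∧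
        σ ∈ indiscernibleAut b,
      ∃ (M : FirstOrder.Language.Theory.ModelType.{u, v, max u v w} T)
        (b : Fin n → M) (σ : M ≃[L] M), ∀ N : ℕ,
        ∃ I ∈ Set.range (symbolicRep σ (instanceSet φ b)),
          ContainsBlock I oneZero N,
      ∃ (M : FirstOrder.Language.Theory.ModelType.{u, v, max u v w} T)
        (σ : M ≃[L] M), ∀ N : ℕ, ∃ b : Fin n → M,
        ∃ I ∈ Set.range (symbolicRep σ (instanceSet φ b)),
          ContainsBlock I oneZero N,
      ∃ (M : FirstOrder.Language.Theory.ModelType.{u, v, max u v w} T)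
        (b : Fin n → M) (σ : M ≃[L] M),
        oneZero ∈
          closure (Set.range (symbolicRep σ (instanceSet φ b))),
      ∃ M : FirstOrder.Language.Theory.ModelType.{u, v, max u v w} T,
        oneZero ∈ totalSymbolicImage φ M] := by
  tfae_have 1 → 3 := HasOrderProperty.exists_symbolicRep_eq
  tfae_have 3 → 2 := fun ⟨M, b, σ, a, h, _⟩ => ⟨M, b, σ, a, h⟩
  tfae_have 2 → 7 := fun ⟨M, b, σ, a, h⟩ =>
    ⟨M, Set.mem_iUnion₂.2 ⟨b, σ, a, h⟩⟩
  tfae_have 7 → 6 := fun ⟨M, h⟩ =>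
    let ⟨b, σ, h⟩ := Set.mem_iUnion₂.1 h
    ⟨M, b, σ, subset_closure h⟩
  tfae_have 6 → 4 := fun ⟨M, b, σ, h⟩ =>
    ⟨M, b, σ, containsBlock_oneZero_of_mem_closure h⟩
  tfae_have 4 → 5 := fun ⟨M, b, σ, h⟩ => ⟨M, σ, fun N => ⟨b, h N⟩⟩
  tfae_have 5 → 1 := fun ⟨M, σ, h⟩ => HasOrderProperty.of_containsBlock M σ h
  tfae_finish
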